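/- Let $d\ge 1$. A \emph{minimal free Cantor system} $(X,\varphi,\mathbb{Z}^d)$ consists of a Cantor set $X$ and an action $\varphi$ of $\mathbb{Z}^d$ on $X$ by homeomorphisms that is free and such that every orbit is dense. An \emph{orbit injection} from $(X,\varphi,\mathbb{Z}^d)$ to $(Y,\psi,\mathbb{Z}^d)$ is a continuous open injection $\theta:X\to Y$ such that for all $x,y\in X$ there is $w\in\mathbb{Z}^d$ with $\varphi^w(x)=y$ if and only if there is $v\in\mathbb{Z}^d$ with $\psi^v(\theta(x))=\theta(y)$. It is \emph{bounded} if its cocycle, the (unique) function $\eta:X\times\mathbb{Z}^d\to\mathbb{Z}^d$ with $\psi^{\eta(x,w)}(\theta(x))=\theta(\varphi^w(x))$ for all $x\in X$ and $w\in\mathbb{Z}^d$, is continuous. Two minimal free Cantor systems $(X,\varphi,\mathbb{Z}^d)$ and $(Y,\psi,\mathbb{Z}^d)$ are \emph{bounded orbit injection equivalent} if there are a minimal free Cantor system $(Z,\alpha,\mathbb{Z}^d)$ and bounded orbit injections from $(X,\varphi,\mathbb{Z}^d)$ and from $(Y,\psi,\mathbb{Z}^d)$ to $(Z,\alpha,\mathbb{Z}^d)$.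 \textbf{Theorem.} For every $d\ge 1$, bounded orbit injection equivalence is an equivalence relation (reflexive, symmetric and transitive) on minimal free Cantor systems $(X,\varphi,\mathbb{Z}^d)$. -/

import Mathlib

universe u v

/-- The group `ℤ^d`. Its (product) topology is the discrete one. -/
abbrev IntLattice (d : ℕ) : Type := Fin d → ℤ

/-- A Cantor set: a topological space homeomorphic to `{0,1}^ℕ`. -/
def IsCantorSet (X : Type u) [TopologicalSpace X] : Prop :=
  Nonempty (X ≃ₜ (ℕ → Bool))

/-- A minimal free Cantor system `(X, φ, ℤ^d)`: a Cantor set `X` with an action `φ` of `ℤ^d` by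
homeomorphisms, written `φ^w x = w +ᵥ x`, which is free and all of whose orbits are dense. -/
structure MinimalFreeCantorSystem (d : ℕ) where
  /-- the underlying space -/
  carrier : Type u
  [topology : TopologicalSpace carrier]
  [action : AddAction (IntLattice d) carrier]
  [continuous_action : ContinuousConstVAdd (IntLattice d) carrier]
  cantor : IsCantorSet carrier
  free : ∀ (w : IntLattice d) (x : carrier), w +ᵥ x = x → w = 0
  minimal : AddAction.IsMinimal (IntLattice d) carrier

attribute [instance] MinimalFreeCantorSystem.topology MinimalFreeCantorSystem.action
  MinimalFreeCantorSystem.continuous_action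

section OrbitInjections

variable (d : ℕ) {X : Type u} {Y : Type v} [TopologicalSpace X] [TopologicalSpace Y]
  [AddAction (IntLattice d) X] [AddAction (IntLattice d) Y]

/-- `θ` is an orbit injection: a continuous open injection such that two points of `X` lie in the
same orbit if and only if their images lie in the same orbit. -/
structure IsOrbitInjection (θ : X → Y) : Prop where
  continuous : Continuous θ
  isOpenMap : IsOpenMap θ
  injective : Function.Injective θ
  orbit_iff : ∀ x y : X, (∃ w : IntLattice d, w +ᵥ x = y) ↔ ∃ v : IntLattice d, v +ᵥ θ x = θ y

/-- `η : X × ℤ^d → ℤ^d` is the cocycle of `θ`: `ψ^{η(x,w)} (θ x) = θ (φ^w x)` for all `x`, `w`. -/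
def IsCocycle (θ : X → Y) (η : X × IntLattice d → IntLattice d) : Prop :=
  ∀ (x : X) (w : IntLattice d), η (x, w) +ᵥ θ x = θ (w +ᵥ x)

/-- `θ` is a bounded orbit injection: an orbit injection with continuous cocycle. (For a free
action on `Y` there is exactly one cocycle, see `IsCocycle.unique` and
`IsOrbitInjection.exists_isCocycle`.) -/
def IsBoundedOrbitInjection (θ : X → Y) : Prop :=
  IsOrbitInjection d θ ∧ ∃ η : X × IntLattice d → IntLattice d, IsCocycle d θ η ∧ Continuous η

end OrbitInjections

theorem IsOrbitInjection.exists_isCocycle {d : ℕ} {X : Type u} {Y : Type v}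
    [TopologicalSpace X] [TopologicalSpace Y] [AddAction (IntLattice d) X] [AddAction (IntLattice d) Y]
    {θ : X → Y} (h : IsOrbitInjection d θ) : ∃ η : X × IntLattice d → IntLattice d, IsCocycle d θ η := by
  choose f hf using fun p : X × IntLattice d => (h.orbit_iff p.1 (p.2 +ᵥ p.1)).1 ⟨p.2, rfl⟩
  exact ⟨f, fun x w => hf (x, w)⟩

theorem IsCocycle.unique {d : ℕ} {X : Type u} {Y : Type v}
    [AddAction (IntLattice d) X] [AddAction (IntLattice d) Y]
    (hfree : ∀ (w : IntLattice d) (y : Y), w +ᵥ y = y → w = 0) {θ : X → Y}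
    {η η' : X × IntLattice d → IntLattice d} (h : IsCocycle d θ η) (h' : IsCocycle d θ η') : η = η' := by
  funext ⟨x, w⟩
  have e : (-η' (x, w) + η (x, w)) +ᵥ θ x = θ x := by
    rw [add_vadd, h x w, ← h' x w, neg_vadd_vadd]
  have := hfree _ _ e
  rw [neg_add_eq_zero] at this
  exact this.symm

/-- Bounded orbit injection equivalence of `S` and `T`: both admit a bounded orbit injection into
a common minimal free Cantor system `R` (with the same group `ℤ^d`). -/
def BoundedOrbitInjectionEquivalent {d : ℕ} (S T : MinimalFreeCantorSystem.{u} d) : Prop :=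
  ∃ R : MinimalFreeCantorSystem.{u} d,
    (∃ θ : S.carrier → R.carrier, IsBoundedOrbitInjection d θ) ∧
    ∃ θ : T.carrier → R.carrier, IsBoundedOrbitInjection d θ

open Filter Topology

/-! Only transitivity has content: given S → R₁ ← T → R₂ ← U, amalgamate R₁ and R₂ over T. The image
of T in R₂ is clopen, so by minimality and compactness a locally constant `f`, with values in a
finite set `s`, translates each y in R₂ into it, say to θ₂(τ y). The pair (τ y, `f y`) determines y.
Replace R₁ by the tower R₁ × (ℤ/2^k)^d with at least |s| levels (`MinimalFreeCantorSystem.induced`),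
and label `s` injectively by levels via ι. Then y ↦ (θ₁(τ y), ι(f y)) is a bounded orbit injection
(`exists_isBoundedOrbitInjection_induced`). R₁ embeds as level 0, so the tower receives both S and
U. -/

/-- For a free action on `Y`, a bounded orbit injection is an open embedding that locally carries
each translation to a translation and reflects the orbit relation. -/
theorem isBoundedOrbitInjection_iff {d : ℕ} {X : Type u} {Y : Type v}
    [TopologicalSpace X] [TopologicalSpace Y] [AddAction (IntLattice d) X]
    [AddAction (IntLattice d) Y] (hfree : ∀ (w : IntLattice d) (y : Y), w +ᵥ y = y → w = 0)
    {θ : X → Y} :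
    IsBoundedOrbitInjection d θ ↔
      IsOpenEmbedding θ ∧
      (∀ (x : X) (w : IntLattice d), ∃ v : IntLattice d, ∀ᶠ x' in 𝓝 x, v +ᵥ θ x' = θ (w +ᵥ x')) ∧
      ∀ (x y : X) (v : IntLattice d), v +ᵥ θ x = θ y → ∃ w : IntLattice d, w +ᵥ x = y := by
  constructor
  · rintro ⟨h, η, hη, hc⟩
    refine ⟨.of_continuous_injective_isOpenMap h.continuous h.injective h.isOpenMap,
      fun x w => ⟨η (x, w), ?_⟩, fun x y v e => (h.orbit_iff x y).2 ⟨v, e⟩⟩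
    have hc' : Continuous fun x' => η (x', w) := by fun_prop
    have : ∀ᶠ x' in 𝓝 x, η (x', w) = η (x, w) :=
      hc'.continuousAt.eventually (IsOpen.mem_nhds (isOpen_discrete {η (x, w)}) rfl)
    filter_upwards [this] with x' hx'
    rw [← hx', hη]
  · rintro ⟨ho, ha, hb⟩
    have hi : IsOrbitInjection d θ := by
      refine ⟨ho.continuous, ho.isOpenMap, ho.injective, fun x y => ⟨?_, fun ⟨v, e⟩ => hb x y v e⟩⟩
      rintro ⟨w, rfl⟩
      obtain ⟨v, hv⟩ := ha x w
      exact ⟨v, hv.self_of_nhds⟩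
    obtain ⟨η, hη⟩ := hi.exists_isCocycle
    refine ⟨hi, η, hη, continuous_prod_of_discrete_right.2 fun w => ?_⟩
    refine (IsLocallyConstant.iff_eventually_eq _).2 (fun x => ?_) |>.continuous
    obtain ⟨v, hv⟩ := ha x w
    -- Freeness pins the cocycle value to any translation that works.
    have key : ∀ x', v +ᵥ θ x' = θ (w +ᵥ x') → η (x', w) = v := by
      intro x' e
      have : (-v + η (x', w)) +ᵥ θ x' = θ x' := by rw [add_vadd, hη, ← e, neg_vadd_vadd]
      exact (neg_add_eq_zero.1 (hfree _ _ this)).symm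
    filter_upwards [hv] with x' hx'
    rw [key x' hx', key x hv.self_of_nhds]

theorem MinimalFreeCantorSystem.isBoundedOrbitInjection_id {d : ℕ}
    (S : MinimalFreeCantorSystem.{u} d) :
    IsBoundedOrbitInjection d (id : S.carrier → S.carrier) :=
  (isBoundedOrbitInjection_iff S.free).2
    ⟨.id, fun _ w => ⟨w, .of_forall fun _ => rfl⟩, fun _ _ v e => ⟨v, e⟩⟩

theorem IsBoundedOrbitInjection.comp {d : ℕ} {S T R : MinimalFreeCantorSystem.{u} d}
    {θ' : T.carrier → R.carrier} {θ : S.carrier → T.carrier}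
    (h' : IsBoundedOrbitInjection d θ') (h : IsBoundedOrbitInjection d θ) :
    IsBoundedOrbitInjection d (θ' ∘ θ) := by
  rw [isBoundedOrbitInjection_iff R.free] at h' ⊢
  rw [isBoundedOrbitInjection_iff T.free] at h
  refine ⟨h'.1.comp h.1, fun x w => ?_, fun x y v e => ?_⟩
  · obtain ⟨v, hv⟩ := h.2.1 x w
    obtain ⟨u, hu⟩ := h'.2.1 (θ x) v
    refine ⟨u, ?_⟩
    filter_upwards [hv, h.1.continuous.continuousAt.eventually hu] with x' h1 h2
    simp only [Function.comp_apply]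
    rw [h2, h1]
  · obtain ⟨w, hw⟩ := h'.2.2 _ _ v e
    exact h.2.2 _ _ w hw

/-- Over the image of a bounded orbit injection, translations pull back locally to translations. -/
theorem IsBoundedOrbitInjection.exists_eventually_vadd_eq {d : ℕ}
    {S T : MinimalFreeCantorSystem.{u} d} {θ : S.carrier → T.carrier}
    (h : IsBoundedOrbitInjection d θ) {x y : S.carrier} {v : IntLattice d}
    (e : v +ᵥ θ x = θ y) :
    ∃ w : IntLattice d, ∀ᶠ x' in 𝓝 x, v +ᵥ θ x' = θ (w +ᵥ x') := by
  obtain ⟨-, ha, hb⟩ := (isBoundedOrbitInjection_iff T.free).1 h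
  obtain ⟨w, rfl⟩ := hb _ _ _ e
  obtain ⟨v', hv'⟩ := ha x w
  have e' : (-v' + v) +ᵥ θ x = θ x := by
    rw [add_vadd, e, ← hv'.self_of_nhds, neg_vadd_vadd]
  obtain rfl : v' = v := neg_add_eq_zero.1 (T.free _ _ e')
  exact ⟨w, hv'⟩

/-! ### Towers: systems induced from a sublattice of finite index -/

/-- Division with remainder by `N` in each coordinate of `ℤ^d`. -/
def latticeDivMod (d N : ℕ) [NeZero N] :
    IntLattice d ≃ IntLattice d × (Fin d → Fin N) where
  toFun w := (fun i => (Int.divModEquiv N (w i)).1, fun i => (Int.divModEquiv N (w i)).2)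
  invFun p := fun i => (Int.divModEquiv N).symm (p.1 i, p.2 i)
  left_inv w := by funext i; simp only [Prod.mk.eta, Equiv.symm_apply_apply]
  right_inv p := by ext i <;> simp only [Equiv.apply_symm_apply]

/-- The representative in `ℤ^d` of a residue vector modulo `N`. -/
def residueLift {d N : ℕ} (a : Fin d → Fin N) : IntLattice d := fun i => (a i : ℤ)

theorem latticeDivMod_symm_apply {d N : ℕ} [NeZero N] (q : IntLattice d) (a : Fin d → Fin N) :
    (latticeDivMod d N).symm (q, a) = N • q + residueLift a := by
  funext i
  simp [latticeDivMod, residueLift, Int.divModEquiv, mul_comm]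

theorem latticeDivMod_eq_iff {d N : ℕ} [NeZero N] {w q : IntLattice d} {a : Fin d → Fin N} :
    latticeDivMod d N w = (q, a) ↔ w = N • q + residueLift a := by
  rw [← Equiv.eq_symm_apply, latticeDivMod_symm_apply]

theorem latticeDivMod_spec {d N : ℕ} [NeZero N] (w : IntLattice d) :
    w = N • (latticeDivMod d N w).1 + residueLift (latticeDivMod d N w).2 :=
  latticeDivMod_eq_iff.1 rfl

/-- The `ℤ^d`-action on `X × (ℤ/N)^d` induced from an action of `N ℤ^d ≅ ℤ^d` on `X`. -/
@[reducible]
def inducedAction (d N : ℕ) [NeZero N] (X : Type u) [AddAction (IntLattice d) X] :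
    AddAction (IntLattice d) (X × (Fin d → Fin N)) where
  vadd w p := ((latticeDivMod d N (w + residueLift p.2)).1 +ᵥ p.1,
    (latticeDivMod d N (w + residueLift p.2)).2)
  zero_vadd p := by
    have : latticeDivMod d N (0 + residueLift p.2) = (0, p.2) := by
      rw [latticeDivMod_eq_iff]; simp
    change (_ +ᵥ _, _) = _
    rw [this, zero_vadd]
  add_vadd w' w p := by
    change (_ +ᵥ _, _) = ((latticeDivMod d N (w' + residueLift
      (latticeDivMod d N (w + residueLift p.2)).2)).1 +ᵥ
        ((latticeDivMod d N (w + residueLift p.2)).1 +ᵥ p.1), (latticeDivMod d N (w' + residueLift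
          (latticeDivMod d N (w + residueLift p.2)).2)).2)
    obtain ⟨⟨q, c⟩, h⟩ : ∃ z, latticeDivMod d N (w + residueLift p.2) = z := ⟨_, rfl⟩
    obtain ⟨⟨q', c'⟩, h'⟩ : ∃ z, latticeDivMod d N (w' + residueLift c) = z := ⟨_, rfl⟩
    have h'' : latticeDivMod d N (w' + w + residueLift p.2) = (q' + q, c') := by
      rw [latticeDivMod_eq_iff] at *
      rw [add_assoc, h, add_left_comm, h', smul_add]
      abel
    rw [h'', h, h', add_vadd]

theorem inducedAction_vadd_eq_iff {d N : ℕ} [NeZero N] {X : Type u} [AddAction (IntLattice d) X]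
    {w : IntLattice d} {p p' : X × (Fin d → Fin N)} :
    (inducedAction d N X).toVAdd.vadd w p = p' ↔
      ∃ q : IntLattice d, q +ᵥ p.1 = p'.1 ∧
        w + residueLift p.2 = N • q + residueLift p'.2 := by
  change (((latticeDivMod d N (w + residueLift p.2)).1 +ᵥ p.1,
    (latticeDivMod d N (w + residueLift p.2)).2) : X × (Fin d → Fin N)) = p' ↔ _
  obtain ⟨x', c⟩ := p'
  rw [Prod.mk.injEq]
  constructor
  · rintro ⟨h, rfl⟩
    exact ⟨_, h, latticeDivMod_spec _⟩
  · rintro ⟨q, h, e⟩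
    rw [latticeDivMod_eq_iff.2 e]
    exact ⟨h, rfl⟩

/-- The coordinates of a finite power of `Bool` are absorbed by `ℕ ⊕ ι ≃ ℕ`. Taking the modulus of
the towers to be a power of 2 makes this applicable. -/
theorem IsCantorSet.prod_finite {X : Type u} [TopologicalSpace X] (h : IsCantorSet X)
    {F : Type*} [TopologicalSpace F] [DiscreteTopology F] {ι : Type*} [Finite ι]
    (e : F ≃ (ι → Bool)) : IsCantorSet (X × F) := by
  obtain ⟨h⟩ := h
  obtain ⟨b⟩ : Nonempty (ℕ ⊕ ι ≃ ℕ) := nonempty_equiv_of_countable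
  let e' : F ≃ₜ (ι → Bool) := e.toHomeomorphOfDiscrete
  exact ⟨(h.prodCongr e').trans <| Homeomorph.sumArrowHomeomorphProdArrow.symm.trans <|
    Homeomorph.piCongrLeft (Y := fun _ => Bool) b⟩

/-- The system on `X × (ℤ/2^k)^d` induced from the action of `2^k ℤ^d ≅ ℤ^d` on `X`. -/
def MinimalFreeCantorSystem.induced {d : ℕ} (S : MinimalFreeCantorSystem.{u} d) (k : ℕ) :
    MinimalFreeCantorSystem.{u} d where
  carrier := S.carrier × (Fin d → Fin (2 ^ k))
  action := inducedAction d (2 ^ k) S.carrier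
  continuous_action := by
    let := inducedAction d (2 ^ k) S.carrier
    refine ⟨fun w => continuous_prod_of_discrete_right.2 fun a => ?_⟩
    change Continuous fun x : S.carrier =>
      ((latticeDivMod d (2 ^ k) (w + residueLift a)).1 +ᵥ x,
        (latticeDivMod d (2 ^ k) (w + residueLift a)).2)
    fun_prop
  cantor := S.cantor.prod_finite (ι := Fin d × Fin k)
    (Fintype.equivOfCardEq (by simp [← pow_mul, mul_comm]))
  free w p h := by
    obtain ⟨q, hq, e⟩ := inducedAction_vadd_eq_iff.1 h
    simpa [S.free _ _ hq] using e
  minimal := by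
    let := inducedAction d (2 ^ k) S.carrier
    refine ⟨fun p => dense_iff_inter_open.2 ?_⟩
    rintro U hU ⟨⟨x, c⟩, hx⟩
    have := S.minimal
    obtain ⟨_, hz, q, rfl⟩ := dense_iff_inter_open.1 (AddAction.dense_orbit (IntLattice d) p.1)
      ((fun x' => (x', c)) ⁻¹' U) (hU.preimage (by fun_prop)) ⟨x, hx⟩
    exact ⟨(q +ᵥ p.1, c), hz, (2 ^ k) • q + residueLift c - residueLift p.2,
      inducedAction_vadd_eq_iff.2 ⟨q, rfl, by simp⟩⟩

/-- The point `(x, a)` of the induced system. -/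
def MinimalFreeCantorSystem.inducedMk {d : ℕ} (S : MinimalFreeCantorSystem.{u} d) (k : ℕ)
    (x : S.carrier) (a : Fin d → Fin (2 ^ k)) : (S.induced k).carrier :=
  (x, a)

namespace MinimalFreeCantorSystem

variable {d : ℕ} {S : MinimalFreeCantorSystem.{u} d} {k : ℕ}

theorem vadd_inducedMk_eq_iff {w : IntLattice d} {x x' : S.carrier} {a a' : Fin d → Fin (2 ^ k)} :
    w +ᵥ S.inducedMk k x a = S.inducedMk k x' a' ↔
      ∃ q : IntLattice d, q +ᵥ x = x' ∧ w + residueLift a = (2 ^ k) • q + residueLift a' :=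
  inducedAction_vadd_eq_iff

theorem inducedMk_inj {x x' : S.carrier} {a a' : Fin d → Fin (2 ^ k)} :
    S.inducedMk k x a = S.inducedMk k x' a' ↔ x = x' ∧ a = a' :=
  Prod.mk.injEq .. ▸ Iff.rfl

theorem map_inducedMk_nhds (x : S.carrier) (a : Fin d → Fin (2 ^ k)) :
    map (fun x => S.inducedMk k x a) (𝓝 x) = 𝓝 (S.inducedMk k x a) := by
  change map (fun x => (x, a)) (𝓝 x) = 𝓝 (x, a)
  rw [nhds_prod_eq, nhds_discrete (Fin d → Fin (2 ^ k)), prod_pure]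

end MinimalFreeCantorSystem

theorem isOpenEmbedding_of_map_nhds_eq {X : Type u} {Y : Type v} [TopologicalSpace X]
    [TopologicalSpace Y] {f : X → Y} (hf : Function.Injective f)
    (h : ∀ x, map f (𝓝 x) = 𝓝 (f x)) : IsOpenEmbedding f :=
  .of_continuous_injective_isOpenMap (continuous_iff_continuousAt.2 fun x => (h x).le) hf
    (isOpenMap_iff_nhds_le.2 fun x => (h x).ge)

/-- On level 0 the translation by `2 ^ k • w` acts as `w` does on the base. -/
theorem MinimalFreeCantorSystem.isBoundedOrbitInjection_inducedMk {d : ℕ}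
    (S : MinimalFreeCantorSystem.{u} d) (k : ℕ) :
    IsBoundedOrbitInjection d (fun x => S.inducedMk k x 0) := by
  refine (isBoundedOrbitInjection_iff (S.induced k).free).2
    ⟨isOpenEmbedding_of_map_nhds_eq (fun x y h => (inducedMk_inj.1 h).1)
      (fun x => map_inducedMk_nhds x 0), fun x w => ⟨(2 ^ k) • w, .of_forall fun x' => ?_⟩, ?_⟩
  · exact vadd_inducedMk_eq_iff.2 ⟨w, rfl, rfl⟩
  · intro x y v e
    obtain ⟨q, hq, -⟩ := vadd_inducedMk_eq_iff.1 e
    exact ⟨q, hq⟩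

/-- A nonempty clopen set is reached from every point by a locally constant choice among finitely
many translations. -/
theorem MinimalFreeCantorSystem.exists_locallyConstant_vadd_mem {d : ℕ}
    (S : MinimalFreeCantorSystem.{u} d) {A : Set S.carrier} (hA : IsClopen A) (hne : A.Nonempty) :
    ∃ (s : Finset (IntLattice d)) (f : S.carrier → s), IsLocallyConstant f ∧
      ∀ x, (f x : IntLattice d) +ᵥ x ∈ A := by
  have := S.minimal
  obtain ⟨h⟩ := S.cantor
  have : CompactSpace S.carrier := h.symm.compactSpace
  obtain ⟨s, hs⟩ := isCompact_univ.exists_finite_cover_vadd (IntLattice d) hA.isOpen hne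
  classical
  have hex : ∀ x : S.carrier, ∃ v : s.image Neg.neg, (v : IntLattice d) +ᵥ x ∈ A := by
    intro x
    obtain ⟨g, hg, hx⟩ := Set.mem_iUnion₂.1 (hs (Set.mem_univ x))
    exact ⟨⟨-g, Finset.mem_image_of_mem _ hg⟩, Set.mem_vadd_set_iff_neg_vadd_mem.1 hx⟩
  -- The set of admissible translations is locally constant because `A` is clopen; choosing from
  -- that set alone keeps the choice locally constant.
  let m : S.carrier → Set (s.image Neg.neg) := fun x => {v | (v : IntLattice d) +ᵥ x ∈ A}
  have hm : IsLocallyConstant m := by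
    refine (IsLocallyConstant.iff_eventually_eq _).2 fun x => ?_
    have : ∀ v : s.image Neg.neg, ∀ᶠ y in 𝓝 x,
        ((v : IntLattice d) +ᵥ y ∈ A ↔ (v : IntLattice d) +ᵥ x ∈ A) := by
      intro v
      have hv : IsClopen ((fun y : S.carrier => (v : IntLattice d) +ᵥ y) ⁻¹' A) :=
        hA.preimage (continuous_const_vadd _)
      by_cases hx : (v : IntLattice d) +ᵥ x ∈ A
      · filter_upwards [hv.isOpen.mem_nhds hx] with y hy using iff_of_true hy hx
      · filter_upwards [hv.compl.isOpen.mem_nhds hx] with y hy using iff_of_false hy hx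
    filter_upwards [eventually_all.2 this] with y hy
    exact Set.ext hy
  obtain ⟨x₀, -⟩ := hne
  have : Nonempty (s.image Neg.neg) := ⟨(hex x₀).choose⟩
  refine ⟨s.image Neg.neg, fun x => Classical.epsilon (· ∈ m x),
    hm.comp fun t => Classical.epsilon (· ∈ t), fun x => ?_⟩
  exact Classical.epsilon_spec (p := (· ∈ m x)) (hex x)

/-- For `d = 0` there is only one residue vector; this is where `1 ≤ d` enters. -/
theorem exists_injective_residues {d : ℕ} (hd : 1 ≤ d) {α : Type*} [Finite α] :
    ∃ (k : ℕ) (ι : α → (Fin d → Fin (2 ^ k))), Function.Injective ι := by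
  have := Fintype.ofFinite α
  let k := Fintype.card α
  have : Fintype.card α ≤ Fintype.card (Fin d → Fin (2 ^ k)) := by
    rw [Fintype.card_fun, Fintype.card_fin, Fintype.card_fin]
    exact Nat.lt_two_pow_self.le.trans (Nat.le_self_pow (by omega) _)
  obtain ⟨ι⟩ := Function.Embedding.nonempty_of_card_le this
  exact ⟨k, ι, ι.injective⟩

/-! ### Amalgamation over a common subsystem -/

theorem exists_isBoundedOrbitInjection_induced {d : ℕ} (hd : 1 ≤ d)
    {T R₁ R₂ : MinimalFreeCantorSystem.{u} d}
    {θ₁ : T.carrier → R₁.carrier} (h₁ : IsBoundedOrbitInjection d θ₁)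
    {θ₂ : T.carrier → R₂.carrier} (h₂ : IsBoundedOrbitInjection d θ₂) :
    ∃ (k : ℕ) (θ : R₂.carrier → (R₁.induced k).carrier), IsBoundedOrbitInjection d θ := by
  obtain ⟨o₁, a₁, b₁⟩ := (isBoundedOrbitInjection_iff R₁.free).1 h₁
  obtain ⟨o₂, a₂, -⟩ := (isBoundedOrbitInjection_iff R₂.free).1 h₂
  obtain ⟨hT⟩ := T.cantor
  obtain ⟨hR⟩ := R₂.cantor
  have : CompactSpace T.carrier := hT.symm.compactSpace
  have : Nonempty T.carrier := ⟨hT.symm fun _ => false⟩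
  have : T2Space R₂.carrier := hR.symm.t2Space
  obtain ⟨s, f, hf, hfA⟩ := R₂.exists_locallyConstant_vadd_mem
    ⟨(isCompact_range o₂.continuous).isClosed, o₂.isOpen_range⟩ (Set.range_nonempty θ₂)
  choose τ hτ using hfA
  have hfe : ∀ y, ∀ᶠ y' in 𝓝 y, f y' = f y := (IsLocallyConstant.iff_eventually_eq _).1 hf
  -- Locally `θ₂ ∘ τ` is one fixed translation, hence a local homeomorphism, and `θ₂` is an open
  -- embedding.
  have hτn : ∀ y, map τ (𝓝 y) = 𝓝 (τ y) := by
    intro y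
    refine map_injective o₂.injective ?_
    rw [o₂.map_nhds_eq, hτ, map_map]
    refine (Filter.map_congr ?_).trans ((Homeomorph.vadd (f y : IntLattice d)).map_nhds_eq y)
    filter_upwards [hfe y] with y' hy'
    rw [Function.comp_apply, hτ, hy', Homeomorph.vadd_apply]
  obtain ⟨k, ι, hι⟩ := exists_injective_residues hd (α := s)
  refine ⟨k, fun y => R₁.inducedMk k (θ₁ (τ y)) (ι (f y)),
    (isBoundedOrbitInjection_iff (R₁.induced k).free).2 ⟨?_, ?_, ?_⟩⟩
  · refine isOpenEmbedding_of_map_nhds_eq (fun y y' h => ?_) fun y => ?_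
    · obtain ⟨h, h'⟩ := MinimalFreeCantorSystem.inducedMk_inj.1 h
      have e := congrArg θ₂ (o₁.injective h)
      rw [hτ, hτ, hι h'] at e
      exact vadd_left_cancel _ e
    · rw [← MinimalFreeCantorSystem.map_inducedMk_nhds, ← o₁.map_nhds_eq, ← hτn, map_map, map_map]
      refine Filter.map_congr ?_
      filter_upwards [hfe y] with y' hy'
      simp only [Function.comp_apply, hy']
  · intro y w
    -- Undo the shift at `y`, move by `w`, then shift at `w +ᵥ y`: this is `w` as seen inside the
    -- image of `θ₂`. It pulls back to `u` on T and pushes forward to `v` on R₁.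
    have e : ∀ y', f y' = f y → f (w +ᵥ y') = f (w +ᵥ y) →
        ((f (w +ᵥ y) : IntLattice d) + w - f y) +ᵥ θ₂ (τ y') = θ₂ (τ (w +ᵥ y')) := by
      intro y' h h'
      rw [hτ, hτ, h, h', vadd_vadd, vadd_vadd, sub_add_cancel]
    obtain ⟨u, hu⟩ := h₂.exists_eventually_vadd_eq (e y rfl rfl)
    obtain ⟨v, hv⟩ := a₁ (τ y) u
    -- Move by `v` in the base and change level from `ι (f y)` to `ι (f (w +ᵥ y))`.
    refine ⟨(2 ^ k) • v + residueLift (ι (f (w +ᵥ y))) - residueLift (ι (f y)), ?_⟩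
    have hw : Tendsto (fun y' : R₂.carrier => w +ᵥ y') (𝓝 y) (𝓝 (w +ᵥ y)) :=
      (continuous_const_vadd w).tendsto y
    have ht : Tendsto τ (𝓝 y) (𝓝 (τ y)) := (hτn y).le
    filter_upwards [hfe y, hw.eventually (hfe (w +ᵥ y)), ht.eventually hu, ht.eventually hv]
      with y' g₁ g₂ g₃ g₄
    rw [g₁, g₂, MinimalFreeCantorSystem.vadd_inducedMk_eq_iff]
    refine ⟨v, ?_, sub_add_cancel _ _⟩
    rw [g₄, ← o₂.injective (g₃.symm.trans (e y' g₁ g₂))]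
  -- An orbit relation in the tower descends to R₁, pulls back to T, and pushes forward to R₂, where
  -- the shifts by `f` are removed.
  · intro y y' v h
    obtain ⟨q, hq, -⟩ := MinimalFreeCantorSystem.vadd_inducedMk_eq_iff.1 h
    obtain ⟨u, hu⟩ := b₁ _ _ _ hq
    obtain ⟨p, hp⟩ := a₂ (τ y) u
    have e := hp.self_of_nhds
    rw [hu, hτ, hτ, vadd_vadd] at e
    exact ⟨-(f y' : IntLattice d) + (p + f y), by rw [add_vadd, e, neg_vadd_vadd]⟩

theorem mainTheorem4 (d : ℕ) (hd : 1 ≤ d) :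
    Equivalence
      (BoundedOrbitInjectionEquivalent :
        MinimalFreeCantorSystem.{u} d → MinimalFreeCantorSystem.{u} d → Prop) := by
  refine ⟨fun S => ⟨S, ⟨id, S.isBoundedOrbitInjection_id⟩, ⟨id, S.isBoundedOrbitInjection_id⟩⟩,
    fun ⟨R, h, h'⟩ => ⟨R, h', h⟩, ?_⟩
  rintro S T U ⟨R₁, ⟨σ, hσ⟩, θ₁, h₁⟩ ⟨R₂, ⟨θ₂, h₂⟩, τ, hτ⟩
  obtain ⟨k, θ, hθ⟩ := exists_isBoundedOrbitInjection_induced hd h₁ h₂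
  exact ⟨R₁.induced k, ⟨_, (R₁.isBoundedOrbitInjection_inducedMk k).comp hσ⟩, θ ∘ τ, hθ.comp hτ⟩
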